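/- Let $M$ be a complete metric space with metric $d$ and a base point $0$. Let $\mathrm{Lip}_0(M)$ be the Banach space of real-valued Lipschitz functions $f$ on $M$ with $f(0)=0$, normed by the Lipschitz constant. Let $\mathcal F(M)\subset \mathrm{Lip}_0(M)^*$ be the Lipschitz-free space, that is, the norm-closed linear span of the evaluation functionals $\delta(x)\colon f\mapsto f(x)$, $x\in M$. Let $M^{\mathcal U}$ be the uniform (Samuel) compactification of $M$, that is, the closure of the image of $M$ in $\mathbb R^{B}$ under $x\mapsto (g(x))_{g\in B}$, where $B$ is the set of all bounded uniformly continuous functions $g\colon M\to\mathbb R$; regard $M$ as a (dense, Borel) subset of $M^{\mathcal U}$. Every $f\in \mathrm{Lip}_0(M)$ has a unique continuous extension $f^{\mathcal U}\colon M^{\mathcal U}\to[-\infty,+\infty]$. A Borel measure on $M^{\mathcal U}$ is understood to be either positive with values in $[0,\infty]$, or signed with real values. It is called Radon if its total variation $|\mu|$ is finite and both inner regular (by compact sets) and outer regular (by open sets) on all Borel sets. For a Borel set $A$, let $\mu|_A(E)=\mu(E\cap A)$; $\mu$ is concentrated on $A$ if $\mu=\mu|_A$. A Borel measure $\mu$ on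 $M^{\mathcal U}$ is called almost Radon if $\mu(\{0\})=0$ and $\mu|_K$ is Radon for every closed $K\subset M^{\mathcal U}$ with $0\notin K$. A measure $\mu$ induces the functional $\phi\in \mathrm{Lip}_0(M)^*$ if, for every $f\in \mathrm{Lip}_0(M)$, $f^{\mathcal U}$ is $\mu$-integrable and $\phi(f)=\int_{M^{\mathcal U}} f^{\mathcal U}\,d\mu$; one then writes $\phi=\mathcal L\mu$. Let $\mu$ be an almost Radon measure on $M^{\mathcal U}$ that induces an element $\mathcal L\mu$ of $\mathrm{Lip}_0(M)^*$. Then the following are equivalent: (i) $\mathcal L\mu\in\mathcal F(M)$; (ii) $\mathcal L\mu=\mathcal L(\mu|_M)$, i.e. $\mu|_M$ induces the same functional as $\mu$; (iii) $\mu$ is concentrated on $M$. -/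

import Mathlib

open MeasureTheory Filter Topology Set

noncomputable section

/-! ### The Lipschitz space, its dual, and the Lipschitz-free space -/

/-- The Lipschitz functions vanishing at `o`, as a linear subspace of the space of all functions. -/
def lip0Submodule (M : Type*) [MetricSpace M] (o : M) : Submodule ℝ (M → ℝ) where
  carrier := {f | (∃ C : ℝ, 0 ≤ C ∧ ∀ x y, |f x - f y| ≤ C * dist x y) ∧ f o = 0}
  zero_mem' := ⟨⟨0, le_rfl, by simp⟩, rfl⟩
  add_mem' := by
    rintro f g ⟨⟨C, hC, hf⟩, hf0⟩ ⟨⟨D, hD, hg⟩, hg0⟩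
    refine ⟨⟨C + D, add_nonneg hC hD, fun x y => ?_⟩, by simp [hf0, hg0]⟩
    calc |f x + g x - (f y + g y)| = |(f x - f y) + (g x - g y)| := by ring_nf
      _ ≤ |f x - f y| + |g x - g y| := abs_add_le _ _
      _ ≤ (C + D) * dist x y := by rw [add_mul]; exact add_le_add (hf x y) (hg x y)
  smul_mem' := by
    rintro c f ⟨⟨C, hC, hf⟩, hf0⟩
    refine ⟨⟨|c| * C, by positivity, fun x y => ?_⟩, by simp [hf0]⟩
    calc |c * f x - c * f y| = |c| * |f x - f y| := by rw [← abs_mul, mul_sub]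
      _ ≤ |c| * C * dist x y := by
        rw [mul_assoc]; exact mul_le_mul_of_nonneg_left (hf x y) (abs_nonneg c)

/-- `Lip₀(M)`: the real-valued Lipschitz functions on `M` vanishing at the base point `o`. -/
def Lip0 (M : Type*) [MetricSpace M] (o : M) : Type _ := lip0Submodule M o

namespace Lip0

variable {M : Type*} [MetricSpace M] {o : M}

instance : AddCommGroup (Lip0 M o) := inferInstanceAs (AddCommGroup (lip0Submodule M o))

instance : Module ℝ (Lip0 M o) := inferInstanceAs (Module ℝ (lip0Submodule M o))

instance : CoeFun (Lip0 M o) (fun _ => M → ℝ) := ⟨fun f => f.1⟩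

theorem ext_fun {f g : Lip0 M o} (h : ∀ x, f x = g x) : f = g := Subtype.ext (funext h)

@[simp] theorem zero_apply (x : M) : (0 : Lip0 M o) x = 0 := rfl

@[simp] theorem add_apply (f g : Lip0 M o) (x : M) : (f + g) x = f x + g x := rfl

@[simp] theorem smul_apply (c : ℝ) (f : Lip0 M o) (x : M) : (c • f) x = c * f x := rfl

/-- The norm of `Lip₀(M)` is the Lipschitz constant. -/
instance : Norm (Lip0 M o) :=
  ⟨fun f => sInf {C : ℝ | 0 ≤ C ∧ ∀ x y, |f x - f y| ≤ C * dist x y}⟩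

theorem norm_def (f : Lip0 M o) :
    ‖f‖ = sInf {C : ℝ | 0 ≤ C ∧ ∀ x y, |f x - f y| ≤ C * dist x y} := rfl

theorem norm_nonneg' (f : Lip0 M o) : 0 ≤ ‖f‖ := Real.sInf_nonneg fun _ h => h.1

theorem norm_le_of {f : Lip0 M o} {C : ℝ} (hC : 0 ≤ C)
    (h : ∀ x y, |f x - f y| ≤ C * dist x y) : ‖f‖ ≤ C :=
  csInf_le ⟨0, fun _ h => h.1⟩ ⟨hC, h⟩

theorem abs_sub_le (f : Lip0 M o) (x y : M) : |f x - f y| ≤ ‖f‖ * dist x y := by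
  rcases eq_or_ne x y with rfl | hxy
  · simp
  · have hd : 0 < dist x y := dist_pos.2 hxy
    rw [← div_le_iff₀ hd]
    refine le_csInf f.2.1 fun C hC => ?_
    rw [div_le_iff₀ hd]
    exact hC.2 x y

theorem abs_apply_le (f : Lip0 M o) (x : M) : |f x| ≤ dist x o * ‖f‖ := by
  have h := abs_sub_le f x o
  have h0 : f o = 0 := f.2.2
  rwa [h0, sub_zero, mul_comm] at h

theorem normCore : NormedSpace.Core ℝ (Lip0 M o) where
  norm_nonneg := norm_nonneg'
  norm_smul c f := by
    have key : ∀ (c : ℝ) (f : Lip0 M o), ‖c • f‖ ≤ |c| * ‖f‖ := fun c f =>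
      norm_le_of (mul_nonneg (abs_nonneg c) (norm_nonneg' f)) fun x y => by
        rw [smul_apply, smul_apply, ← mul_sub, abs_mul, mul_assoc]
        exact mul_le_mul_of_nonneg_left (abs_sub_le f x y) (abs_nonneg c)
    refine le_antisymm (key c f) ?_
    rcases eq_or_ne c 0 with rfl | hc
    · simpa using norm_nonneg' ((0 : ℝ) • f)
    · have h := key c⁻¹ (c • f)
      rw [smul_smul, inv_mul_cancel₀ hc, one_smul, abs_inv] at h
      have hc' : 0 < |c| := abs_pos.2 hc
      rw [Real.norm_eq_abs]
      calc |c| * ‖f‖ ≤ |c| * (|c|⁻¹ * ‖c • f‖) := mul_le_mul_of_nonneg_left h hc'.le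
        _ = ‖c • f‖ := by rw [← mul_assoc, mul_inv_cancel₀ hc'.ne', one_mul]
  norm_triangle f g :=
    norm_le_of (add_nonneg (norm_nonneg' f) (norm_nonneg' g)) fun x y => by
      calc |(f + g) x - (f + g) y| = |(f x - f y) + (g x - g y)| := by
            rw [add_apply, add_apply]; ring_nf
        _ ≤ |f x - f y| + |g x - g y| := abs_add_le _ _
        _ ≤ (‖f‖ + ‖g‖) * dist x y := by
            rw [add_mul]; exact add_le_add (abs_sub_le f x y) (abs_sub_le g x y)
  norm_eq_zero_iff f := by
    constructor
    · intro h
      refine ext_fun fun x => ?_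
      have := abs_apply_le f x
      rw [h, mul_zero] at this
      simpa using abs_nonpos_iff.1 this
    · rintro rfl
      exact le_antisymm (norm_le_of le_rfl (by simp)) (norm_nonneg' _)

instance : NormedAddCommGroup (Lip0 M o) := NormedAddCommGroup.ofCore normCore

instance : NormedSpace ℝ (Lip0 M o) := NormedSpace.ofCore normCore

theorem uniformContinuous (f : Lip0 M o) : UniformContinuous (f : M → ℝ) := by
  refine (LipschitzWith.of_dist_le_mul (K := ⟨‖f‖, norm_nonneg' f⟩) fun x y => ?_).uniformContinuous
  rw [Real.dist_eq]
  exact abs_sub_le f x y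

/-- The evaluation functional `δ(x) : f ↦ f x`. -/
def delta (o x : M) : StrongDual ℝ (Lip0 M o) :=
  LinearMap.mkContinuous
    { toFun := fun f => f x
      map_add' := fun _ _ => rfl
      map_smul' := fun _ _ => rfl }
    (dist x o) (fun f => abs_apply_le f x)

end Lip0

/-- The Lipschitz-free space `F(M)`: the norm-closed linear span of the evaluation functionals
in `Lip₀(M)*`. -/
def lipFree (M : Type*) [MetricSpace M] (o : M) : Submodule ℝ (StrongDual ℝ (Lip0 M o)) :=
  (Submodule.span ℝ (range (Lip0.delta o))).topologicalClosure

/-! ### The uniform (Samuel) compactification -/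

/-- The bounded uniformly continuous real functions on `M`. -/
def BddUnif (M : Type*) [MetricSpace M] : Type _ :=
  {f : M → ℝ // UniformContinuous f ∧ ∃ C : ℝ, ∀ x, |f x| ≤ C}

/-- The map sending a point to the family of its values under all bounded uniformly continuous
functions. -/
def bddUnifEval (M : Type*) [MetricSpace M] (x : M) : BddUnif M → ℝ := fun f => f.1 x

/-- The uniform (Samuel) compactification of `M`: the closure of the image of `M` in the product
of copies of `ℝ` indexed by the bounded uniformly continuous functions. -/
def UComp (M : Type*) [MetricSpace M] : Type _ := closure (range (bddUnifEval M))

namespace UComp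

variable {M : Type*} [MetricSpace M]

instance : TopologicalSpace (UComp M) :=
  inferInstanceAs (TopologicalSpace (closure (range (bddUnifEval M))))

instance : T2Space (UComp M) := inferInstanceAs (T2Space (closure (range (bddUnifEval M))))

instance : CompactSpace (UComp M) := by
  refine isCompact_iff_compactSpace.1 ?_
  choose C hC using fun f : BddUnif M => f.2.2
  refine (isCompact_univ_pi fun f => isCompact_Icc (a := -C f) (b := C f)).of_isClosed_subset
    isClosed_closure (closure_minimal ?_ (isClosed_set_pi fun f _ => isClosed_Icc))
  rintro _ ⟨x, rfl⟩ f -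
  exact abs_le.1 (hC f x)

instance : MeasurableSpace (UComp M) := borel _

instance : BorelSpace (UComp M) := ⟨rfl⟩

/-- The canonical embedding of `M` into its uniform compactification. -/
def ι (x : M) : UComp M := ⟨bddUnifEval M x, subset_closure ⟨x, rfl⟩⟩

/-- The continuous extension of a bounded uniformly continuous function. -/
def coord (f : BddUnif M) (ζ : UComp M) : ℝ := ζ.1 f

theorem continuous_coord (f : BddUnif M) : Continuous (coord f) :=
  (continuous_apply f).comp continuous_subtype_val

theorem continuous_ι : Continuous (ι : M → UComp M) :=
  Continuous.subtype_mk (continuous_pi fun f => f.2.1.continuous) _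

/-- The bounded uniformly continuous function `min (d(x, a)) ε`. -/
def truncDist (a : M) (ε : ℝ) (hε : 0 ≤ ε) : BddUnif M :=
  ⟨fun x => min (dist x a) ε,
    ((LipschitzWith.dist_left a).min_const ε).uniformContinuous, ε, fun x => by
      rw [abs_of_nonneg (le_min dist_nonneg hε)]
      exact min_le_right _ _⟩

theorem isDenseInducing_ι : IsDenseInducing (ι : M → UComp M) := by
  refine IsDenseInducing.mk' _ continuous_ι (fun ζ => ?_) fun a s hs => ?_
  · refine closure_subtype.2 ?_
    refine closure_mono ?_ ζ.2
    rintro _ ⟨x, rfl⟩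
    exact ⟨ι x, ⟨x, rfl⟩, rfl⟩
  · obtain ⟨ε, hε, hs⟩ := Metric.mem_nhds_iff.1 hs
    let f := truncDist a ε hε.le
    refine ⟨coord f ⁻¹' Iio ε, ?_, fun b hb => hs ?_⟩
    · refine (isOpen_Iio.preimage (continuous_coord f)).mem_nhds ?_
      change min (dist a a) ε < ε
      simpa using hε
    · have : min (dist b a) ε < ε := hb
      exact (min_lt_iff.1 this).resolve_right (lt_irrefl _)

/-- The extension of a real function on `M` to a `[-∞, +∞]`-valued function on the uniform
compactification, by continuity. -/
def extend (f : M → ℝ) : UComp M → EReal :=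
  isDenseInducing_ι.extend fun x => (f x : EReal)

theorem exists_tendsto {f : M → ℝ} (hf : UniformContinuous f) (ζ : UComp M) :
    ∃ c : EReal, Tendsto (fun x => (f x : EReal)) (comap ι (𝓝 ζ)) (𝓝 c) := by
  have hlip : LipschitzWith 1 Real.arctan := by
    refine lipschitzWith_of_nnnorm_deriv_le Real.differentiable_arctan fun x => ?_
    rw [← NNReal.coe_le_coe, coe_nnnorm, Real.deriv_arctan, Real.norm_eq_abs,
      abs_of_nonneg (by positivity)]
    exact div_le_one_of_le₀ (by nlinarith [sq_nonneg x]) (by positivity)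
  let g : BddUnif M := ⟨fun x => Real.arctan (f x), hlip.uniformContinuous.comp hf, Real.pi / 2,
    fun x => abs_le.2 ⟨(Real.neg_pi_div_two_lt_arctan _).le, (Real.arctan_lt_pi_div_two _).le⟩⟩
  have hg : Tendsto (fun x => Real.arctan (f x)) (comap ι (𝓝 ζ)) (𝓝 (coord g ζ)) :=
    ((continuous_coord g).tendsto ζ).comp tendsto_comap
  rcases le_or_gt (Real.pi / 2) (coord g ζ) with h | h
  · refine ⟨⊤, EReal.tendsto_coe_nhds_top_iff.2 (tendsto_atTop.2 fun y => ?_)⟩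
    filter_upwards [hg.eventually (lt_mem_nhds ((Real.arctan_lt_pi_div_two y).trans_le h))]
      with x hx
    exact (Real.arctan_strictMono.lt_iff_lt.1 hx).le
  rcases le_or_gt (coord g ζ) (-(Real.pi / 2)) with h' | h'
  · refine ⟨⊥, EReal.tendsto_coe_nhds_bot_iff.2 (tendsto_atBot.2 fun y => ?_)⟩
    filter_upwards [hg.eventually (gt_mem_nhds (h'.trans_lt (Real.neg_pi_div_two_lt_arctan y)))]
      with x hx
    exact (Real.arctan_strictMono.lt_iff_lt.1 hx).le
  · refine ⟨(Real.tan (coord g ζ) : ℝ), (continuous_coe_real_ereal.tendsto _).comp ?_⟩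
    have hcos : Real.cos (coord g ζ) ≠ 0 := (Real.cos_pos_of_mem_Ioo ⟨h', h⟩).ne'
    simpa [Function.comp_def, Real.tan_arctan] using
      (Real.continuousAt_tan.2 hcos).tendsto.comp hg

theorem continuous_extend {f : M → ℝ} (hf : UniformContinuous f) : Continuous (extend f) :=
  isDenseInducing_ι.continuous_extend (exists_tendsto hf)

theorem extend_ι {f : M → ℝ} (hf : UniformContinuous f) (x : M) : extend f (ι x) = f x :=
  isDenseInducing_ι.extend_eq (continuous_coe_real_ereal.comp hf.continuous) x

/-- A complete metric space is a Borel (indeed `Gδ`) subset of its uniform compactification. -/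
theorem measurableSet_range_ι [CompleteSpace M] :
    MeasurableSet (range (ι : M → UComp M)) := by
  have key : range (ι : M → UComp M) =
      ⋂ n : ℕ, ⋃ p : M, coord (truncDist p 1 zero_le_one) ⁻¹' Iio (1 / ((n : ℝ) + 1)) := by
    refine Subset.antisymm ?_ fun ζ hζ => ?_
    · rintro _ ⟨x, rfl⟩
      refine mem_iInter.2 fun n => mem_iUnion.2 ⟨x, ?_⟩
      change min (dist x x) 1 < 1 / ((n : ℝ) + 1)
      rw [dist_self, min_eq_left zero_le_one]
      positivity
    · have hne : (comap ι (𝓝 ζ) : Filter M).NeBot := isDenseInducing_ι.comap_nhds_neBot ζ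
      have hc : Cauchy (comap ι (𝓝 ζ) : Filter M) := by
        refine Metric.cauchy_iff.2 ⟨hne, fun ε hε => ?_⟩
        obtain ⟨n, hn⟩ := exists_nat_one_div_lt (half_pos hε)
        obtain ⟨p, hp⟩ := mem_iUnion.1 (mem_iInter.1 hζ n)
        refine ⟨_, preimage_mem_comap
          ((isOpen_Iio.preimage (continuous_coord _)).mem_nhds hp), fun x hx y hy => ?_⟩
        have hn1 : 1 / ((n : ℝ) + 1) ≤ 1 :=
          div_le_one_of_le₀ (by linarith [n.cast_nonneg (α := ℝ)]) (by positivity)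
        have hx' : min (dist x p) 1 < 1 / ((n : ℝ) + 1) := hx
        have hy' : min (dist y p) 1 < 1 / ((n : ℝ) + 1) := hy
        have hx2 := (min_lt_iff.1 hx').resolve_right (not_lt.2 hn1)
        have hy2 := (min_lt_iff.1 hy').resolve_right (not_lt.2 hn1)
        linarith [dist_triangle_right x y p]
      obtain ⟨x, hx⟩ := CompleteSpace.complete hc
      exact ⟨x, tendsto_nhds_unique ((continuous_ι.tendsto x).mono_left hx) tendsto_comap⟩
  rw [key]
  exact MeasurableSet.iInter fun n =>
    (isOpen_iUnion fun p => isOpen_Iio.preimage (continuous_coord _)).measurableSet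

end UComp

/-! ### Borel measures, Radon and almost Radon measures -/

/-- A (Borel) measure is either positive with values in `[0, ∞]`, or signed and real-valued. -/
inductive GenMeasure (X : Type*) [MeasurableSpace X] : Type _
  | pos (μ : Measure X)
  | signed (μ : SignedMeasure X)

namespace GenMeasure

variable {X : Type*} [MeasurableSpace X]

/-- The value `μ(A)`. -/
def value : GenMeasure X → Set X → EReal
  | pos μ, A => (μ A : EReal)
  | signed μ, A => (μ A : ℝ)

/-- The total variation measure `|μ|`. -/
def variation : GenMeasure X → Measure X
  | pos μ => μ
  | signed μ => μ.totalVariation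

/-- The restriction `E ↦ μ(E ∩ A)` of `μ` to a measurable set `A`, as a measure on the same
space. -/
def restrict : GenMeasure X → Set X → GenMeasure X
  | pos μ, A => pos (μ.restrict A)
  | signed μ, A => signed (VectorMeasure.restrict μ A)

/-- `μ` is concentrated on `A` if it equals its restriction to `A`. -/
def ConcentratedOn (μ : GenMeasure X) (A : Set X) : Prop := μ = μ.restrict A

/-- The integral of a real function; against a signed measure, the difference of the integrals
against its positive and negative parts. -/
def integral : GenMeasure X → (X → ℝ) → ℝ
  | pos μ, g => ∫ x, g x ∂μ
  | signed μ, g => ∫ x, g x ∂μ.toJordanDecomposition.posPart -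
      ∫ x, g x ∂μ.toJordanDecomposition.negPart

/-- Radon: finite, and `|μ|` is inner regular (by compact sets) and outer regular (by open sets)
on all measurable sets. -/
def IsRadon [TopologicalSpace X] (μ : GenMeasure X) : Prop :=
  IsFiniteMeasure μ.variation ∧ μ.variation.InnerRegular ∧ μ.variation.OuterRegular

/-- Almost Radon with respect to the point `p`: `p` has measure zero, and the restriction to any
closed set that does not contain `p` is Radon. -/
def IsAlmostRadon [TopologicalSpace X] (μ : GenMeasure X) (p : X) : Prop :=
  μ.value {p} = 0 ∧ ∀ K : Set X, IsClosed K → p ∉ K → (μ.restrict K).IsRadon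

/-- A `[-∞, +∞]`-valued measurable function `g` has integral `r ∈ ℝ` against `μ`: the integral of
`|g|` against `|μ|` is finite (so `g` is finite almost everywhere), and `r` is the integral. -/
def HasIntegral (μ : GenMeasure X) (g : X → EReal) (r : ℝ) : Prop :=
  ∫⁻ x, (g x).abs ∂μ.variation < ⊤ ∧ μ.integral (fun x => (g x).toReal) = r

end GenMeasure

/-- The measure `μ` on the uniform compactification induces the functional `φ ∈ Lip₀(M)*`: for every
`f ∈ Lip₀(M)`, the integral of the extension of `f` exists and equals `φ f`. -/
def Induces {M : Type*} [MetricSpace M] {o : M} (μ : GenMeasure (UComp M))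
    (φ : StrongDual ℝ (Lip0 M o)) : Prop :=
  ∀ f : Lip0 M o, μ.HasIntegral (UComp.extend f) (φ f)

end

noncomputable section

/-! ### Separation properties of the compactification: base point, `M`, Lipschitz functions. -/

namespace UComp

variable {M : Type*} [MetricSpace M]

/-! The substantial implications are (i) ⇒ (iii) and (ii) ⇒ (i); (iii) ⇒ (ii) is a substitution.

(i) ⇒ (iii): since `M` is complete, the points outside `M` form a countable union of sets of points
at distance at least `r` from `M` (`exists_forall_le_coord_truncDist`), so it suffices that each of
these is `|μ|`-null. An element `φ` of the free space is close in norm to a functional `ψ` supported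
on a finite set `F`. The cutoff `V = min(d(·, F ∪ {o}), r)` kills `ψ`, equals `r` at every point far
from `M`, and `V * G` has a Lipschitz constant bounded independently of `F`; hence `φ (V * G)` is as
small as desired (`exists_cutoff_of_mem_lipFree`). For positive `μ`, take `G = 1` and apply Markov's
inequality. For signed `μ`, take `G` Lipschitz and close in `L¹(|μ|)` to the sign of `μ`, so that `φ
(V * G)` is nearly `∫ V d|μ|`.

(ii) ⇒ (i): `φ` is the Bochner integral of `δ` against `μ|_M`, and the integral stays in the closed
subspace containing the values. The bound `‖δ(x)‖ ≤ d(x, o)` gives integrability, and inner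
regularity gives strong measurability (`aestronglyMeasurable_deltaExt`). -/

theorem eq_of_eq_on_range {Y : Type*} [TopologicalSpace Y] [T2Space Y] {F G : UComp M → Y}
    (hF : Continuous F) (hG : Continuous G) (h : ∀ x, F (ι x) = G (ι x)) : F = G :=
  isDenseInducing_ι.dense.equalizer hF hG (funext h)

theorem extend_eq_coe {f : M → ℝ} (hf : UniformContinuous f) {G : UComp M → ℝ}
    (hG : Continuous G) (h : ∀ x, f x = G (ι x)) (ζ : UComp M) :
    extend f ζ = (G ζ : EReal) := by
  refine congrFun (eq_of_eq_on_range (continuous_extend hf)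
    (continuous_coe_real_ereal.comp hG) fun x => ?_) ζ
  rw [extend_ι hf, h x, Function.comp_apply]

theorem tendsto_coord (g : BddUnif M) (ζ : UComp M) :
    Tendsto g.1 (comap ι (𝓝 ζ)) (𝓝 (coord g ζ)) :=
  ((continuous_coord g).tendsto ζ).comp tendsto_comap

instance (ζ : UComp M) : (comap (ι : M → UComp M) (𝓝 ζ)).NeBot :=
  isDenseInducing_ι.comap_nhds_neBot ζ

theorem coord_eq_of_eventually {g : BddUnif M} {ζ : UComp M} {c : ℝ}
    (h : ∀ᶠ x in comap ι (𝓝 ζ), g.1 x = c) : coord g ζ = c :=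
  tendsto_nhds_unique (tendsto_coord g ζ) (tendsto_nhds_of_eventually_eq h)

theorem ι_injective : Function.Injective (ι : M → UComp M) := fun x y h => by
  have h1 : min (dist x y) 1 = min (dist y y) 1 :=
    congrArg (coord (truncDist y 1 zero_le_one)) h
  rw [dist_self, min_eq_left zero_le_one] at h1
  by_contra hne
  exact (lt_min (dist_pos.2 hne) one_pos).ne' h1

theorem coord_nonneg {g : BddUnif M} (h : ∀ x, 0 ≤ g.1 x) (ζ : UComp M) : 0 ≤ coord g ζ :=
  ge_of_tendsto' (tendsto_coord g ζ) h

theorem coord_le {g : BddUnif M} {c : ℝ} (h : ∀ x, g.1 x ≤ c) (ζ : UComp M) : coord g ζ ≤ c :=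
  le_of_tendsto' (tendsto_coord g ζ) h

/-- A point of the compactification at distance zero from `p ∈ M` is `p` itself. -/
theorem eq_ι_of_coord_truncDist_le_zero {p : M} {ζ : UComp M}
    (h : coord (truncDist p 1 zero_le_one) ζ ≤ 0) : ζ = ι p := by
  have hle : comap ι (𝓝 ζ) ≤ 𝓝 p := by
    refine Metric.nhds_basis_ball.ge_iff.2 fun ε hε => ?_
    have hlt : coord (truncDist p 1 zero_le_one) ζ < min ε 1 := h.trans_lt (lt_min hε one_pos)
    filter_upwards [(tendsto_coord _ ζ).eventually (gt_mem_nhds hlt)] with x hx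
    have hx' : min (dist x p) 1 < min ε 1 := hx
    rcases min_lt_iff.1 hx' with h1 | h1
    · exact h1.trans_le (min_le_left _ _)
    · exact absurd (min_le_right ε 1) (not_le.2 h1)
  exact tendsto_nhds_unique tendsto_comap ((continuous_ι.tendsto p).mono_left hle)

/-- The closed set of points at distance at least `1 / (n + 1)` from `o`. -/
def farFrom (o : M) (n : ℕ) : Set (UComp M) :=
  {ζ | 1 / ((n : ℝ) + 1) ≤ coord (truncDist o 1 zero_le_one) ζ}

theorem isClosed_farFrom (o : M) (n : ℕ) : IsClosed (farFrom o n) :=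
  isClosed_le continuous_const (continuous_coord _)

theorem ι_notMem_farFrom (o : M) (n : ℕ) : ι o ∉ farFrom o n := by
  have h : min (dist o o) 1 < 1 / ((n : ℝ) + 1) := by
    rw [dist_self, min_eq_left zero_le_one]
    positivity
  exact not_le.2 h

theorem monotone_farFrom (o : M) : Monotone (farFrom o) := fun _ _ hmn _ hζ =>
  le_trans (Nat.one_div_le_one_div hmn) (mem_ofPred.1 hζ)

/-- This exhausts the complement of the base point by closed sets, to which the almost Radon
hypothesis applies. -/
theorem iUnion_farFrom (o : M) : ⋃ n, farFrom o n = {ι o}ᶜ := by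
  ext ζ
  refine ⟨fun h hζ => ?_, fun h => ?_⟩
  · obtain ⟨n, hn⟩ := mem_iUnion.1 h
    rw [mem_singleton_iff.1 hζ] at hn
    exact ι_notMem_farFrom o n hn
  · have hpos : 0 < coord (truncDist o 1 zero_le_one) ζ :=
      not_le.1 fun hle => h (eq_ι_of_coord_truncDist_le_zero hle)
    obtain ⟨n, hn⟩ := exists_nat_one_div_lt hpos
    exact mem_iUnion.2 ⟨n, hn.le⟩

/-- A point outside a complete space `M` is at positive distance from `M`. -/
theorem exists_forall_le_coord_truncDist [CompleteSpace M] {ζ : UComp M}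
    (hζ : ζ ∉ range (ι : M → UComp M)) :
    ∃ n : ℕ, ∀ p : M, 1 / ((n : ℝ) + 1) ≤
      coord (truncDist p (1 / ((n : ℝ) + 1)) (by positivity)) ζ := by
  by_contra! hcon
  -- Otherwise the trace on `M` of the neighbourhoods of `ζ` enters arbitrarily small balls, hence
  -- converges in `M`. Truncating at the radius itself makes `min (dist x p) r < r` say exactly
  -- `dist x p < r`.
  have hc : Cauchy (comap ι (𝓝 ζ) : Filter M) := by
    refine Metric.cauchy_iff.2 ⟨inferInstance, fun ε hε => ?_⟩
    obtain ⟨n, hn⟩ := exists_nat_one_div_lt (half_pos hε)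
    obtain ⟨p, hp⟩ := hcon n
    refine ⟨_, preimage_mem_comap
      ((isOpen_Iio.preimage (continuous_coord _)).mem_nhds hp), fun x hx y hy => ?_⟩
    have hx2 := (min_lt_iff.1 (show min (dist x p) _ < _ from hx)).resolve_right (lt_irrefl _)
    have hy2 := (min_lt_iff.1 (show min (dist y p) _ < _ from hy)).resolve_right (lt_irrefl _)
    linarith [dist_triangle_right x y p]
  obtain ⟨x, hx⟩ := CompleteSpace.complete hc
  exact hζ ⟨x, tendsto_nhds_unique ((continuous_ι.tendsto x).mono_left hx) tendsto_comap⟩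

/-- The bounded Lipschitz function `min (d(x, S)) r`. -/
def truncInfDist (S : Set M) (r : ℝ) (hr : 0 ≤ r) : BddUnif M :=
  ⟨fun x => min (Metric.infDist x S) r,
    ((Metric.lipschitz_infDist_pt S).min_const r).uniformContinuous, r, fun x => by
      rw [abs_of_nonneg (le_min Metric.infDist_nonneg hr)]
      exact min_le_right _ _⟩

theorem abs_truncInfDist_sub_le (S : Set M) {r : ℝ} (hr : 0 ≤ r) (x y : M) :
    |(truncInfDist S r hr).1 x - (truncInfDist S r hr).1 y| ≤ dist x y := by
  have := ((Metric.lipschitz_infDist_pt S).min_const r).dist_le_mul x y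
  rwa [Real.dist_eq, NNReal.coe_one, one_mul] at this

/-- Each point of `M` has a nearest point in the finite set `F`, so one of finitely many closed
equalities holds on the dense set `M`, and therefore at `ζ`. Finiteness keeps the union of these
closed sets closed. -/
theorem coord_truncInfDist_eq {F : Set M} (hF : F.Finite) (hne : F.Nonempty) {r : ℝ}
    (hr : 0 ≤ r) {ζ : UComp M} (hζ : ∀ p : M, r ≤ coord (truncDist p r hr) ζ) :
    coord (truncInfDist F r hr) ζ = r := by
  have hclosed : IsClosed
      (⋃ p ∈ F, {η | coord (truncDist p r hr) η = coord (truncInfDist F r hr) η}) :=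
    hF.isClosed_biUnion fun p _ => isClosed_eq (continuous_coord _) (continuous_coord _)
  have huniv : ζ ∈ ⋃ p ∈ F, {η | coord (truncDist p r hr) η = coord (truncInfDist F r hr) η} := by
    refine hclosed.closure_subset_iff.2 ?_ (isDenseInducing_ι.dense ζ)
    rintro _ ⟨x, rfl⟩
    obtain ⟨p, hp, hpx⟩ := hF.isCompact.exists_infDist_eq_dist hne x
    refine mem_biUnion hp ?_
    change min (dist x p) r = min (Metric.infDist x F) r
    rw [hpx]
  obtain ⟨p, -, hp⟩ := mem_iUnion₂.1 huniv
  exact le_antisymm (coord_le (fun x => min_le_right _ _) ζ) ((hζ p).trans_eq hp)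

/-- The continuous functions on the compactification whose restriction to `M` is Lipschitz. -/
def lipschitzSubalgebra (M : Type*) [MetricSpace M] : Subalgebra ℝ C(UComp M, ℝ) where
  carrier := {G | ∃ C : ℝ, ∀ x y : M, |G (ι x) - G (ι y)| ≤ C * dist x y}
  algebraMap_mem' c := ⟨0, fun x y => by simp⟩
  add_mem' := by
    rintro F G ⟨C, hC⟩ ⟨D, hD⟩
    refine ⟨C + D, fun x y => ?_⟩
    have h := abs_add_le (F (ι x) - F (ι y)) (G (ι x) - G (ι y))
    simp only [ContinuousMap.add_apply]
    rw [add_sub_add_comm]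
    linarith [hC x y, hD x y]
  mul_mem' := by
    rintro F G ⟨C, hC⟩ ⟨D, hD⟩
    refine ⟨‖F‖ * D + ‖G‖ * C, fun x y => ?_⟩
    simp only [ContinuousMap.mul_apply]
    rw [show F (ι x) * G (ι x) - F (ι y) * G (ι y) =
      F (ι x) * (G (ι x) - G (ι y)) + G (ι y) * (F (ι x) - F (ι y)) by ring]
    refine (abs_add_le _ _).trans ?_
    rw [abs_mul, abs_mul, add_mul, mul_assoc, mul_assoc]
    exact add_le_add
      (mul_le_mul (F.norm_coe_le_norm _) (hD x y) (abs_nonneg _) (norm_nonneg _))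
      (mul_le_mul (G.norm_coe_le_norm _) (hC x y) (abs_nonneg _) (norm_nonneg _))

/-- Uniform continuity of a separating `u` puts the regions where `u` is near its two values at
distance at least `δ`; the truncated distance to one region is Lipschitz and separates the points.
-/
theorem lipschitzSubalgebra_separatesPoints : (lipschitzSubalgebra M).SeparatesPoints := by
  intro ζ ξ hne
  obtain ⟨u, hu⟩ : ∃ u : BddUnif M, coord u ζ ≠ coord u ξ := by
    by_contra! h
    exact hne (Subtype.ext (funext h))
  -- One third each for closeness at `ζ`, closeness at `ξ`, and the modulus of continuity of `u`.
  set η := |coord u ζ - coord u ξ| / 3 with hη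
  have hη0 : 0 < η := div_pos (abs_pos.2 (sub_ne_zero.2 hu)) three_pos
  obtain ⟨δ, hδ, hδu⟩ := Metric.uniformContinuous_iff.1 u.2.1 η hη0
  let S : Set M := {x | dist (u.1 x) (coord u ζ) < η}
  have hS : ∀ᶠ x in comap ι (𝓝 ζ), x ∈ S :=
    (tendsto_coord u ζ).eventually (Metric.ball_mem_nhds _ hη0)
  have hT : ∀ᶠ x in comap ι (𝓝 ξ), dist (u.1 x) (coord u ξ) < η :=
    (tendsto_coord u ξ).eventually (Metric.ball_mem_nhds _ hη0)
  let v := truncInfDist S δ hδ.le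
  have hvζ : coord v ζ = 0 := coord_eq_of_eventually <| by
    filter_upwards [hS] with x hx
    change min (Metric.infDist x S) δ = 0
    rw [Metric.infDist_zero_of_mem hx, min_eq_left hδ.le]
  have hvξ : coord v ξ = δ := coord_eq_of_eventually <| by
    filter_upwards [hT] with x hx
    refine min_eq_right ((Metric.le_infDist hS.exists).2 fun y hy => ?_)
    by_contra! hlt
    have h1 := hδu hlt
    have hy' : dist (u.1 y) (coord u ζ) < η := hy
    have h2 : dist (coord u ζ) (coord u ξ) ≤ _ := dist_triangle4_left (u.1 y) (u.1 x) _ _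
    rw [Real.dist_eq (coord u ζ), dist_comm (u.1 y) (u.1 x)] at h2
    linarith
  refine ⟨coord v, ⟨⟨coord v, continuous_coord v⟩, ⟨1, fun x y => ?_⟩, rfl⟩, ?_⟩
  · rw [one_mul]
    exact abs_truncInfDist_sub_le S hδ.le x y
  · rw [hvζ, hvξ]
    exact hδ.ne

end UComp

/-! ### Evaluation functionals and cutoffs for elements of the free space. -/

section LipFree

variable {M : Type*} [MetricSpace M] {o : M}

@[simp] theorem Lip0.delta_apply (x : M) (f : Lip0 M o) : Lip0.delta o x f = f x := rfl

theorem Lip0.norm_delta_sub_le (x y : M) :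
    ‖Lip0.delta o x - Lip0.delta o y‖ ≤ dist x y :=
  ContinuousLinearMap.opNorm_le_bound _ dist_nonneg fun f => by
    rw [sub_apply, delta_apply, delta_apply, Real.norm_eq_abs, mul_comm]
    exact Lip0.abs_sub_le f x y

theorem Lip0.continuous_delta : Continuous (Lip0.delta o) := by
  refine (LipschitzWith.of_dist_le_mul (K := 1) fun x y => ?_).continuous
  rw [dist_eq_norm, NNReal.coe_one, one_mul]
  exact Lip0.norm_delta_sub_le x y

theorem delta_mem_lipFree (x : M) : Lip0.delta o x ∈ lipFree M o :=
  Submodule.le_topologicalClosure _ (Submodule.subset_span ⟨x, rfl⟩)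

theorem exists_finite_support_of_mem_span {ψ : StrongDual ℝ (Lip0 M o)}
    (hψ : ψ ∈ Submodule.span ℝ (range (Lip0.delta o))) :
    ∃ F : Set M, F.Finite ∧ ∀ f : Lip0 M o, (∀ x ∈ F, f x = 0) → ψ f = 0 := by
  induction hψ using Submodule.span_induction with
  | mem ψ h =>
    obtain ⟨x, rfl⟩ := h
    exact ⟨{x}, finite_singleton x, fun f hf => hf x rfl⟩
  | zero => exact ⟨∅, finite_empty, fun f _ => rfl⟩
  | add ψ₁ ψ₂ _ _ h₁ h₂ =>
    obtain ⟨F₁, hF₁, h₁⟩ := h₁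
    obtain ⟨F₂, hF₂, h₂⟩ := h₂
    refine ⟨F₁ ∪ F₂, hF₁.union hF₂, fun f hf => ?_⟩
    rw [add_apply, h₁ f fun x hx => hf x (Or.inl hx), h₂ f fun x hx => hf x (Or.inr hx), add_zero]
  | smul c ψ _ h =>
    obtain ⟨F, hF, h⟩ := h
    exact ⟨F, hF, fun f hf => by rw [smul_apply, h f hf, smul_zero]⟩

/-- An element `φ` of the free space is small on suitable Lipschitz multiples `V * G` of a given
function `G`, where the cutoff `V` attains its maximum `r` at all points whose distance to `M` is
at least `r`. -/
theorem exists_cutoff_of_mem_lipFree {φ : StrongDual ℝ (Lip0 M o)} (hφ : φ ∈ lipFree M o)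
    {r : ℝ} (hr : 0 ≤ r) {G : C(UComp M, ℝ)} (hG : G ∈ UComp.lipschitzSubalgebra M)
    {ε : ℝ} (hε : 0 < ε) :
    ∃ (f : Lip0 M o) (V : C(UComp M, ℝ)), (∀ ζ, 0 ≤ V ζ) ∧ (∀ ζ, V ζ ≤ r) ∧
      (∀ ζ, (∀ p, r ≤ UComp.coord (UComp.truncDist p r hr) ζ) → V ζ = r) ∧
      (∀ x, f x = V (UComp.ι x) * G (UComp.ι x)) ∧ |φ f| < ε := by
  obtain ⟨L, hL⟩ := hG
  -- A Lipschitz constant for `v * G` that does not depend on `F`, so `ψ` can be chosen accurately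
  -- enough before its support is known.
  set C : ℝ := r * |L| + ‖G‖ with hC
  have hC0 : 0 ≤ C := by positivity
  obtain ⟨ψ, hψ, hd⟩ := Metric.mem_closure_iff.1 hφ (ε / (C + 1)) (by positivity)
  obtain ⟨F, hF, hFψ⟩ := exists_finite_support_of_mem_span hψ
  -- Inserting `o` makes the product vanish at the base point and keeps the set nonempty.
  let v := UComp.truncInfDist (insert o F) r hr
  have hv0 : ∀ x, 0 ≤ v.1 x := fun x => le_min Metric.infDist_nonneg hr
  have hvr : ∀ x, v.1 x ≤ r := fun x => min_le_right _ _
  have hvF : ∀ x ∈ insert o F, v.1 x = 0 := fun x hx => by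
    change min (Metric.infDist x _) r = 0
    rw [Metric.infDist_zero_of_mem hx, min_eq_left hr]
  have hlip : ∀ x y, |v.1 x * G (UComp.ι x) - v.1 y * G (UComp.ι y)| ≤ C * dist x y := by
    intro x y
    rw [show v.1 x * G (UComp.ι x) - v.1 y * G (UComp.ι y) =
      v.1 x * (G (UComp.ι x) - G (UComp.ι y)) + G (UComp.ι y) * (v.1 x - v.1 y) by ring]
    refine (abs_add_le _ _).trans ?_
    rw [abs_mul, abs_mul, hC, add_mul, mul_assoc, abs_of_nonneg (hv0 x)]
    refine add_le_add (mul_le_mul (hvr x) ((hL x y).trans ?_) (abs_nonneg _) hr)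
      (mul_le_mul (G.norm_coe_le_norm _) (UComp.abs_truncInfDist_sub_le _ hr x y)
        (abs_nonneg _) (norm_nonneg _))
    exact mul_le_mul_of_nonneg_right (le_abs_self L) dist_nonneg
  let f : Lip0 M o := ⟨fun x => v.1 x * G (UComp.ι x), ⟨C, hC0, hlip⟩, by
    simp [hvF o (mem_insert o F)]⟩
  have hf : ∀ x, f x = v.1 x * G (UComp.ι x) := fun x => rfl
  refine ⟨f, ⟨UComp.coord v, UComp.continuous_coord v⟩, UComp.coord_nonneg hv0,
    UComp.coord_le hvr, fun ζ hζ => UComp.coord_truncInfDist_eq (hF.insert o)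
      (insert_nonempty o F) hr hζ, hf, ?_⟩
  have hψf : ψ f = 0 := hFψ f fun x hx => by
    rw [hf, hvF x (mem_insert_of_mem o hx), zero_mul]
  have h1 : |φ f| ≤ ‖φ - ψ‖ * ‖f‖ := by
    simpa [hψf] using (φ - ψ).le_opNorm f
  rw [dist_eq_norm] at hd
  calc |φ f| ≤ ‖φ - ψ‖ * C :=
        h1.trans (mul_le_mul_of_nonneg_left (Lip0.norm_le_of hC0 hlip) (norm_nonneg _))
    _ ≤ ε / (C + 1) * C := mul_le_mul_of_nonneg_right hd.le hC0
    _ < ε := by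
      rw [div_mul_eq_mul_div, div_lt_iff₀ (by positivity)]
      nlinarith

end LipFree

/-! ### Restriction of signed measures, and vector integrals in closed subspaces. -/

namespace MeasureTheory.SignedMeasure

variable {X : Type*} [MeasurableSpace X]

/-- The restricted parts remain mutually singular and have the right difference, so uniqueness of
the Jordan decomposition applies. -/
theorem toJordanDecomposition_restrict (s : SignedMeasure X) {A : Set X} (hA : MeasurableSet A) :
    SignedMeasure.toJordanDecomposition (VectorMeasure.restrict s A) =
      ⟨s.toJordanDecomposition.posPart.restrict A, s.toJordanDecomposition.negPart.restrict A,
        s.toJordanDecomposition.mutuallySingular.mono Measure.restrict_le_self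
          Measure.restrict_le_self⟩ := by
  refine toJordanDecomposition_eq ?_
  ext E hE
  rw [VectorMeasure.restrict_apply _ hA hE, apply_eq_posPart_real_sub_negPart_real s (hE.inter hA),
    JordanDecomposition.toSignedMeasure, Measure.toSignedMeasure_sub_apply hE,
    measureReal_restrict_apply hE, measureReal_restrict_apply hE]

theorem totalVariation_restrict (s : SignedMeasure X) {A : Set X} (hA : MeasurableSet A) :
    SignedMeasure.totalVariation (VectorMeasure.restrict s A) = s.totalVariation.restrict A := by
  rw [totalVariation, toJordanDecomposition_restrict s hA, totalVariation, Measure.restrict_add]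

/-- A point lies on one side of the Hahn decomposition, so one Jordan part gives it no mass;
cancellation then forces the other to vanish there too. -/
theorem totalVariation_singleton_eq_zero [MeasurableSingletonClass X] {s : SignedMeasure X} {x : X}
    (h : s {x} = 0) : s.totalVariation {x} = 0 := by
  obtain ⟨P, hP, hp, hn⟩ := s.toJordanDecomposition.mutuallySingular
  have hs := apply_eq_posPart_real_sub_negPart_real s (measurableSet_singleton x)
  rw [h] at hs
  have heq : s.toJordanDecomposition.posPart.real {x} = s.toJordanDecomposition.negPart.real {x} :=
    by linarith
  rw [measureReal_eq_measureReal_iff] at heq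
  rw [totalVariation, Measure.add_apply, add_eq_zero]
  by_cases hx : x ∈ P
  · have h0 := measure_mono_null (singleton_subset_iff.2 hx) hp
    exact ⟨h0, heq ▸ h0⟩
  · have h0 := measure_mono_null (singleton_subset_iff.2 (mem_compl hx)) hn
    exact ⟨heq.trans h0, h0⟩

end MeasureTheory.SignedMeasure

/-- The quotient map by the closed subspace commutes with the integral and kills every value of `f`.
-/
theorem Submodule.integral_mem {X E : Type*} [MeasurableSpace X] [NormedAddCommGroup E]
    [NormedSpace ℝ E] [CompleteSpace E] {μ : Measure X} (S : Submodule ℝ E)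
    (hS : IsClosed (S : Set E)) {f : X → E} (hf : Integrable f μ) (h : ∀ x, f x ∈ S) :
    ∫ x, f x ∂μ ∈ S := by
  have : IsClosed (S : Set E) := hS
  have hc := S.mkQL.integral_comp_comm hf
  have h0 : ∀ x, S.mkQL (f x) = 0 := fun x => (Submodule.Quotient.mk_eq_zero S).2 (h x)
  simp only [h0, integral_zero] at hc
  exact (Submodule.Quotient.mk_eq_zero S).1 hc.symm

namespace GenMeasure

variable {X : Type*} [MeasurableSpace X]

theorem variation_restrict (μ : GenMeasure X) {A : Set X} (hA : MeasurableSet A) :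
    (μ.restrict A).variation = μ.variation.restrict A := by
  cases μ with
  | pos μ => rfl
  | signed μ => exact μ.totalVariation_restrict hA

theorem concentratedOn_of_variation_compl_eq_zero {μ : GenMeasure X} {A : Set X}
    (hA : MeasurableSet A) (h : μ.variation Aᶜ = 0) : μ.ConcentratedOn A := by
  cases μ with
  | pos μ => exact congrArg pos (Measure.restrict_eq_self_of_ae_mem (mem_ae_iff.2 h)).symm
  | signed μ =>
    refine congrArg signed ?_
    ext E hE
    have h0 : μ (E \ (E ∩ A)) = 0 :=
      μ.null_of_totalVariation_zero (measure_mono_null (fun x hx hA => hx.2 ⟨hx.1, hA⟩) h)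
    rw [VectorMeasure.restrict_apply _ hA hE]
    rw [← VectorMeasure.of_add_of_sdiff (hE.inter hA) hE inter_subset_left, h0, add_zero]

end GenMeasure

/-! ### Regularity, and the Bochner integral of the evaluation functionals. -/

namespace UComp

variable {M : Type*} [MetricSpace M] {o : M}

/-- A measure without mass at `o` that is inner regular away from `o` is inner regular. -/
theorem innerRegular_of_forall_restrict {m : Measure (UComp M)} (ho : m {ι o} = 0)
    (hm : ∀ n, (m.restrict (farFrom o n)).InnerRegular) : m.InnerRegular := by
  refine ⟨fun U hU r hr => ?_⟩
  have hunion : m U = m (⋃ n, U ∩ farFrom o n) := by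
    rw [← inter_iUnion, iUnion_farFrom, ← sdiff_eq, measure_sdiff_null ho]
  rw [hunion, (monotone_const.inter (monotone_farFrom o)).measure_iUnion] at hr
  obtain ⟨n, hn⟩ := lt_iSup_iff.1 hr
  have hcl := (isClosed_farFrom o n).measurableSet
  rw [← Measure.restrict_apply hU] at hn
  obtain ⟨K, hKU, hK, hrK⟩ := (hm n).innerRegular hU r hn
  exact ⟨K, hKU, hK, hrK.trans_le (Measure.restrict_apply_le _ _)⟩

/-- The evaluation functionals, extended by zero to the compactification. -/
def deltaExt (o : M) : UComp M → StrongDual ℝ (Lip0 M o) :=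
  Function.extend ι (Lip0.delta o) 0

theorem deltaExt_ι (o x : M) : deltaExt o (ι x) = Lip0.delta o x :=
  ι_injective.extend_apply _ _ _

theorem deltaExt_mem_lipFree (o : M) (ζ : UComp M) : deltaExt o ζ ∈ lipFree M o := by
  by_cases h : ζ ∈ range (ι : M → UComp M)
  · obtain ⟨x, rfl⟩ := h
    rw [deltaExt_ι]
    exact delta_mem_lipFree x
  · rw [deltaExt, Function.extend_apply' _ _ _ h]
    exact zero_mem _

theorem continuousOn_deltaExt (o : M) : ContinuousOn (deltaExt o) (range ι) := by
  rw [continuousOn_iff_continuous_domRestrict]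
  have hemb : IsEmbedding (ι : M → UComp M) := ⟨isDenseInducing_ι.isInducing, ι_injective⟩
  rw [← hemb.toHomeomorph.symm.symm.comp_continuous_iff']
  refine Lip0.continuous_delta.congr fun x => ?_
  exact (deltaExt_ι o x).symm

/-- `M` need not be separable, so continuity on `M` is not enough by itself. On each `farFrom o n`,
inner regularity fills `M` up to a null set by countably many compact sets, where continuity does
suffice. -/
theorem aestronglyMeasurable_deltaExt [CompleteSpace M] {m : Measure (UComp M)}
    (hfin : ∀ n, IsFiniteMeasure (m.restrict (farFrom o n)))
    (hreg : ∀ n, (m.restrict (farFrom o n)).InnerRegular) :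
    AEStronglyMeasurable (deltaExt o) (m.restrict (range ι)) := by
  have hR := measurableSet_range_ι (M := M)
  have hcpt : ∀ K ⊆ range (ι : M → UComp M), IsCompact K → ∀ m' : Measure (UComp M),
      AEStronglyMeasurable (deltaExt o) (m'.restrict K) := fun K hKR hK m' =>
    ((continuousOn_deltaExt o).mono hKR).aestronglyMeasurable_of_isCompact hK hK.measurableSet
  have hfar : ∀ n, AEStronglyMeasurable (deltaExt o)
      ((m.restrict (farFrom o n)).restrict (range ι)) := by
    intro n
    have := hfin n
    have := hreg n
    set m' := m.restrict (farFrom o n)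
    choose K hKR hK hlt using fun k : ℕ => hR.exists_isCompact_sdiff_lt (measure_ne_top m' _)
      (ENNReal.inv_ne_zero.2 (ENNReal.natCast_ne_top (k + 1)))
    have h0 : m' (range ι \ ⋃ k, K k) = 0 := by
      refine le_antisymm (ENNReal.le_of_forall_pos_le_add fun ε hε _ => ?_) zero_le
      obtain ⟨k, hk⟩ := ENNReal.exists_inv_nat_lt (ENNReal.coe_ne_zero.2 hε.ne')
      rw [zero_add]
      refine (measure_mono (sdiff_subset_sdiff_right (subset_iUnion K k))).trans
        ((hlt k).le.trans (le_trans ?_ hk.le))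
      exact ENNReal.inv_le_inv.2 (by exact_mod_cast k.le_succ)
    have hU : AEStronglyMeasurable (deltaExt o) (m'.restrict (⋃ k, K k)) :=
      aestronglyMeasurable_iUnion_iff.2 fun k => hcpt _ (hKR k) (hK k) m'
    have hD : AEStronglyMeasurable (deltaExt o) (m'.restrict (range ι \ ⋃ k, K k)) := by
      rw [Measure.restrict_eq_zero.2 h0]
      exact aestronglyMeasurable_zero_measure _
    exact (aestronglyMeasurable_union_iff.2 ⟨hU, hD⟩).mono_measure
      (Measure.restrict_mono (by rw [union_sdiff_self]; exact subset_union_right) le_rfl)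
  -- The sets `farFrom o n` miss only the base point, which is itself compact.
  have hpt : AEStronglyMeasurable (deltaExt o) (m.restrict {ι o}) :=
    hcpt _ (singleton_subset_iff.2 (mem_range_self o)) isCompact_singleton m
  have hall : AEStronglyMeasurable (deltaExt o)
      ((m.restrict (range ι)).restrict ((⋃ n, farFrom o n) ∪ {ι o})) := by
    refine aestronglyMeasurable_union_iff.2 ⟨aestronglyMeasurable_iUnion_iff.2 fun n => ?_, ?_⟩
    · rw [Measure.restrict_restrict (isClosed_farFrom o n).measurableSet, inter_comm,
        ← Measure.restrict_restrict hR]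
      exact hfar n
    · exact hpt.mono_measure (Measure.restrict_mono_measure Measure.restrict_le_self _)
  rwa [iUnion_farFrom, compl_union_self, Measure.restrict_univ] at hall

/-- The distance to the base point, as an element of `Lip₀(M)`. -/
def distLip0 (o : M) : Lip0 M o :=
  ⟨fun x => dist x o, ⟨1, zero_le_one, fun x y => by
    rw [one_mul]; exact abs_dist_sub_le x y o⟩, dist_self o⟩

/-- A measure on `M` with finite first moment represents an element of the free space. -/
theorem exists_mem_lipFree_of_finite_moment [CompleteSpace M] {m : Measure (UComp M)}
    (hmeas : AEStronglyMeasurable (deltaExt o) (m.restrict (range ι)))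
    (hint : ∫⁻ ζ, (extend (distLip0 o) ζ).abs ∂m.restrict (range ι) < ⊤) :
    ∃ ψ ∈ lipFree M o, ∀ f : Lip0 M o, ψ f = ∫ ζ, (extend f ζ).toReal ∂m.restrict (range ι) := by
  have hR := measurableSet_range_ι (M := M)
  have hI : Integrable (deltaExt o) (m.restrict (range ι)) := by
    -- On `M`, `‖δ(x)‖ ≤ d(x, o)`, so the finite first moment dominates the norm.
    refine ⟨hmeas, lt_of_le_of_lt (setLIntegral_mono' hR ?_) hint⟩
    rintro _ ⟨x, rfl⟩
    rw [deltaExt_ι, extend_ι (distLip0 o).uniformContinuous, EReal.abs_def, ← ofReal_norm]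
    refine ENNReal.ofReal_le_ofReal ?_
    refine (LinearMap.mkContinuous_norm_le _ dist_nonneg _).trans (le_abs_self _)
  refine ⟨∫ ζ, deltaExt o ζ ∂m.restrict (range ι), Submodule.integral_mem _
    (Submodule.isClosed_topologicalClosure _) hI (deltaExt_mem_lipFree o), fun f => ?_⟩
  rw [ContinuousLinearMap.integral_apply hI]
  refine setIntegral_congr_fun hR ?_
  rintro _ ⟨x, rfl⟩
  change deltaExt o (ι x) f = (extend f (ι x)).toReal
  rw [deltaExt_ι, extend_ι f.uniformContinuous, EReal.toReal_coe, Lip0.delta_apply]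

end UComp

/-! ### Points far from `M` are null when the functional lies in the free space. -/

namespace UComp

variable {M : Type*} [MetricSpace M] {o : M}

/-- The points of the compactification whose distance to `M` is at least `r`. -/
def farFromAll (M : Type*) [MetricSpace M] (r : ℝ) (hr : 0 ≤ r) : Set (UComp M) :=
  {ζ | ∀ p : M, r ≤ coord (truncDist p r hr) ζ}

/-- Weak regularity gives `L¹`-approximation by a continuous function, and Stone–Weierstrass
replaces it uniformly by a member of the subalgebra. -/
theorem exists_lipschitz_integral_sub_le {m : Measure (UComp M)} [IsFiniteMeasure m]
    [m.WeaklyRegular] {s : UComp M → ℝ} (hs : Integrable s m) {ε : ℝ} (hε : 0 < ε) :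
    ∃ G ∈ lipschitzSubalgebra M, ∫ ζ, |s ζ - G ζ| ∂m ≤ ε := by
  obtain ⟨g, hg, hgi⟩ := hs.exists_boundedContinuous_integral_sub_le (half_pos hε)
  set C := m.real univ
  have hC : 0 ≤ C := measureReal_nonneg
  obtain ⟨G, hG⟩ := ContinuousMap.exists_mem_subalgebra_near_continuous_of_separatesPoints
    (lipschitzSubalgebra M) lipschitzSubalgebra_separatesPoints g g.continuous
    (ε / 2 / (C + 1)) (by positivity)
  have hGi : Integrable (G : C(UComp M, ℝ)) m :=
    (G : C(UComp M, ℝ)).continuous.integrable_of_hasCompactSupport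
      (HasCompactSupport.of_compactSpace _)
  refine ⟨G, G.2, ?_⟩
  calc ∫ ζ, |s ζ - (G : C(UComp M, ℝ)) ζ| ∂m ≤ ∫ ζ, (‖s ζ - g ζ‖ + ε / 2 / (C + 1)) ∂m := by
        refine integral_mono (hs.sub hGi).abs ((hs.sub hgi).norm.add (integrable_const _))
          fun ζ => ?_
        have h1 := abs_sub_le (s ζ) (g ζ) ((G : C(UComp M, ℝ)) ζ)
        have h2 := hG ζ
        rw [Real.norm_eq_abs, abs_sub_comm] at h2
        simp only [Real.norm_eq_abs]
        linarith
    _ = ∫ ζ, ‖s ζ - g ζ‖ ∂m + C * (ε / 2 / (C + 1)) := by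
        have hsg : Integrable (fun ζ => ‖s ζ - g ζ‖) m := (hs.sub hgi).norm
        rw [integral_add hsg (integrable_const _), integral_const, smul_eq_mul]
    _ ≤ ε / 2 + ε / 2 := by
        refine add_le_add hg ?_
        rw [mul_div_assoc', div_le_iff₀ (by positivity)]
        nlinarith
    _ = ε := add_halves ε

/-- With `G = 1`, `φ f` is the integral of the cutoff itself and Markov's inequality concludes. This
works for infinite `μ`, since inducing `φ` already makes `V` integrable. -/
theorem measure_farFromAll_eq_zero_of_pos {μ : Measure (UComp M)} {φ : StrongDual ℝ (Lip0 M o)}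
    (hφ : Induces (GenMeasure.pos μ) φ) (hF : φ ∈ lipFree M o) {r : ℝ} (hr : 0 < r) :
    μ (farFromAll M r hr.le) = 0 := by
  have key : ∀ ε : ℝ, 0 < ε → ENNReal.ofReal r * μ (farFromAll M r hr.le) ≤ ENNReal.ofReal ε := by
    intro ε hε
    obtain ⟨f, V, hV0, -, hVr, hf, hfε⟩ :=
      exists_cutoff_of_mem_lipFree hF hr.le (one_mem (lipschitzSubalgebra M)) hε
    have hext : ∀ ζ, extend f ζ = (V ζ : EReal) := extend_eq_coe f.uniformContinuous V.continuous
      fun x => by simp [hf x]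
    obtain ⟨hfin, hint⟩ := hφ f
    simp only [hext, EReal.abs_def, abs_of_nonneg (hV0 _), EReal.toReal_coe,
      GenMeasure.variation, GenMeasure.integral] at hfin hint
    have hVi : Integrable V μ := (lintegral_ofReal_ne_top_iff_integrable
      V.continuous.aestronglyMeasurable (.of_forall hV0)).1 hfin.ne
    calc ENNReal.ofReal r * μ (farFromAll M r hr.le)
        ≤ ENNReal.ofReal r * μ {ζ | ENNReal.ofReal r ≤ ENNReal.ofReal (V ζ)} := by
          gcongr
          exact fun ζ hζ => (congrArg ENNReal.ofReal (hVr ζ hζ)).ge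
      _ ≤ ∫⁻ ζ, ENNReal.ofReal (V ζ) ∂μ :=
          mul_meas_ge_le_lintegral V.continuous.measurable.ennreal_ofReal _
      _ = ENNReal.ofReal (φ f) := by
          rw [← hint, ofReal_integral_eq_lintegral_ofReal hVi (.of_forall hV0)]
      _ ≤ ENNReal.ofReal ε := ENNReal.ofReal_le_ofReal ((le_abs_self _).trans hfε.le)
  have h0 : ENNReal.ofReal r * μ (farFromAll M r hr.le) = 0 := by
    refine le_antisymm (ENNReal.le_of_forall_pos_le_add fun ε hε _ => ?_) zero_le
    simpa using key ε hε
  exact (mul_eq_zero.1 h0).resolve_left (ENNReal.ofReal_pos.2 hr).ne'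

/-- With `s` the sign of `μ` and `G` close to `s`, `∫ V d|μ| = ∫ V s dμ ≤ φ f + ∫ V |s - G| d|μ|`,
and both terms are small because `V ≤ r`. -/
theorem totalVariation_farFromAll_eq_zero {μ : SignedMeasure (UComp M)}
    [μ.totalVariation.WeaklyRegular] {φ : StrongDual ℝ (Lip0 M o)}
    (hφ : Induces (GenMeasure.signed μ) φ) (hF : φ ∈ lipFree M o) {r : ℝ} (hr : 0 < r) :
    μ.totalVariation (farFromAll M r hr.le) = 0 := by
  set m := μ.totalVariation
  set m₁ := μ.toJordanDecomposition.posPart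
  set m₂ := μ.toJordanDecomposition.negPart
  have hadd : m = m₁ + m₂ := rfl
  obtain ⟨P, hP, hP₁, hP₂⟩ := μ.toJordanDecomposition.mutuallySingular
  -- `P` is null for the positive part and `Pᶜ` for the negative part, so `s` is the density of `μ`
  -- with respect to `|μ|`.
  let s : UComp M → ℝ := P.indicator (fun _ => -1) + Pᶜ.indicator (fun _ => 1)
  have hs1 : ∀ ζ ∈ P, s ζ = -1 := fun ζ h => by simp [s, h]
  have hs2 : ∀ ζ ∉ P, s ζ = 1 := fun ζ h => by simp [s, h]
  have hsi : Integrable s m :=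
    ((integrable_const _).indicator hP).add ((integrable_const _).indicator hP.compl)
  have hcont : ∀ H : C(UComp M, ℝ), Integrable H m := fun H =>
    H.continuous.integrable_of_hasCompactSupport (HasCompactSupport.of_compactSpace _)
  have key : ∀ ε : ℝ, 0 < ε → r * m.real (farFromAll M r hr.le) ≤ ε + r * ε := by
    intro ε hε
    obtain ⟨G, hG, hsG⟩ := exists_lipschitz_integral_sub_le hsi hε
    obtain ⟨f, V, hV0, hVle, hVr, hf, hfε⟩ := exists_cutoff_of_mem_lipFree hF hr.le hG hε
    have hext : ∀ ζ, extend f ζ = ((V * G) ζ : EReal) :=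
      extend_eq_coe f.uniformContinuous (V * G).continuous hf
    obtain ⟨-, hint⟩ := hφ f
    simp only [hext, EReal.toReal_coe, GenMeasure.integral] at hint
    have hVG : Integrable (V * G : C(UComp M, ℝ)) m := hcont _
    have hVs : Integrable (fun ζ => V ζ * |s ζ - G ζ|) m :=
      ((hsi.sub (hcont G)).abs).bdd_mul (c := r) V.continuous.aestronglyMeasurable
        (.of_forall fun ζ => by rw [Real.norm_eq_abs, abs_of_nonneg (hV0 ζ)]; exact hVle ζ)
    have hV : Integrable V m := hcont V
    have e₁ : ∫ ζ, V ζ ∂m₁ ≤ ∫ ζ, (V * G) ζ ∂m₁ + ∫ ζ, V ζ * |s ζ - G ζ| ∂m₁ := by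
      rw [hadd, integrable_add_measure] at hVG hVs hV
      rw [← integral_add hVG.1 hVs.1]
      refine integral_mono_ae hV.1 (hVG.1.add hVs.1) ?_
      filter_upwards [measure_eq_zero_iff_ae_notMem.1 hP₁] with ζ hζ
      rw [hs2 ζ hζ, ContinuousMap.mul_apply]
      nlinarith [hV0 ζ, le_abs_self (1 - G ζ)]
    have e₂ : ∫ ζ, V ζ ∂m₂ ≤ -∫ ζ, (V * G) ζ ∂m₂ + ∫ ζ, V ζ * |s ζ - G ζ| ∂m₂ := by
      rw [hadd, integrable_add_measure] at hVG hVs hV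
      have hneg : Integrable (fun ζ => -(V * G) ζ) m₂ := hVG.2.neg
      rw [← integral_neg, ← integral_add hneg hVs.2]
      refine integral_mono_ae hV.2 (hneg.add hVs.2) ?_
      filter_upwards [measure_eq_zero_iff_ae_notMem.1 hP₂] with ζ hζ
      rw [hs1 ζ (not_not.1 hζ), ContinuousMap.mul_apply]
      nlinarith [hV0 ζ, neg_le_abs (-1 - G ζ)]
    have e₃ : ∫ ζ, V ζ * |s ζ - G ζ| ∂m ≤ r * ε := by
      refine le_trans ?_ (mul_le_mul_of_nonneg_left hsG hr.le)
      rw [← integral_const_mul]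
      exact integral_mono hVs ((hsi.sub (hcont G)).abs.const_mul r)
        fun ζ => mul_le_mul_of_nonneg_right (hVle ζ) (abs_nonneg _)
    have e₄ : r * m.real (farFromAll M r hr.le) ≤ ∫ ζ, V ζ ∂m := by
      refine le_trans (mul_le_mul_of_nonneg_left (measureReal_mono ?_) hr.le)
        (mul_meas_ge_le_integral_of_nonneg (.of_forall hV0) hV r)
      exact fun ζ hζ => (hVr ζ hζ).ge
    have e₅ : ∫ ζ, V ζ ∂m = ∫ ζ, V ζ ∂m₁ + ∫ ζ, V ζ ∂m₂ := by
      rw [hadd, integrable_add_measure] at hV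
      rw [hadd, integral_add_measure hV.1 hV.2]
    have e₆ : ∫ ζ, V ζ * |s ζ - G ζ| ∂m =
        ∫ ζ, V ζ * |s ζ - G ζ| ∂m₁ + ∫ ζ, V ζ * |s ζ - G ζ| ∂m₂ := by
      rw [hadd, integrable_add_measure] at hVs
      rw [hadd, integral_add_measure hVs.1 hVs.2]
    linarith [le_abs_self (φ f)]
  have h0 : r * m.real (farFromAll M r hr.le) ≤ 0 := by
    refine le_of_forall_pos_le_add fun ε hε => ?_
    refine (key (ε / (1 + r)) (by positivity)).trans_eq ?_
    field_simp
    ring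
  have h1 : m.real (farFromAll M r hr.le) = 0 :=
    le_antisymm (nonpos_of_mul_nonpos_right h0 hr) measureReal_nonneg
  exact (measureReal_eq_zero_iff).1 h1

end UComp

/-! ### The two main implications. -/

section

variable {M : Type*} [MetricSpace M] {o : M} {μ : GenMeasure (UComp M)}

theorem GenMeasure.IsAlmostRadon.restrict_farFrom (hμ : μ.IsAlmostRadon (UComp.ι o)) (n : ℕ) :
    IsFiniteMeasure (μ.variation.restrict (UComp.farFrom o n)) ∧
      (μ.variation.restrict (UComp.farFrom o n)).InnerRegular := by
  have hcl := UComp.isClosed_farFrom o n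
  rw [← μ.variation_restrict hcl.measurableSet]
  have h := hμ.2 _ hcl (UComp.ι_notMem_farFrom o n)
  exact ⟨h.1, h.2.1⟩

theorem concentratedOn_range_of_mem_lipFree [CompleteSpace M] (hμ : μ.IsAlmostRadon (UComp.ι o))
    {φ : StrongDual ℝ (Lip0 M o)} (hφ : Induces μ φ) (hF : φ ∈ lipFree M o) :
    μ.ConcentratedOn (range UComp.ι) := by
  refine GenMeasure.concentratedOn_of_variation_compl_eq_zero UComp.measurableSet_range_ι ?_
  have hsub : (range (UComp.ι : M → UComp M))ᶜ ⊆
      ⋃ n : ℕ, UComp.farFromAll M (1 / ((n : ℝ) + 1)) (by positivity) := fun ζ hζ =>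
    mem_iUnion.2 (UComp.exists_forall_le_coord_truncDist hζ)
  refine measure_mono_null hsub (measure_iUnion_null fun n => ?_)
  have hr : 0 < 1 / ((n : ℝ) + 1) := by positivity
  cases μ with
  | pos μ => exact UComp.measure_farFromAll_eq_zero_of_pos hφ hF hr
  | signed μ =>
    -- Vanishing of the signed value at the base point gives vanishing variation there, which
    -- upgrades regularity away from `o` to regularity of the whole measure.
    have ho : μ.totalVariation {UComp.ι o} = 0 :=
      SignedMeasure.totalVariation_singleton_eq_zero (EReal.coe_eq_zero.1 hμ.1)
    have : μ.totalVariation.InnerRegular :=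
      UComp.innerRegular_of_forall_restrict ho fun n => (hμ.restrict_farFrom n).2
    exact UComp.totalVariation_farFromAll_eq_zero hφ hF hr

theorem mem_lipFree_of_induces_restrict_range [CompleteSpace M]
    (hμ : μ.IsAlmostRadon (UComp.ι o))
    {φ : StrongDual ℝ (Lip0 M o)}
    (hφ : Induces (μ.restrict (range (UComp.ι : M → UComp M))) φ) : φ ∈ lipFree M o := by
  have hR := UComp.measurableSet_range_ι (M := M)
  have hmeas := UComp.aestronglyMeasurable_deltaExt
    (fun n => (hμ.restrict_farFrom n).1) (fun n => (hμ.restrict_farFrom n).2)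
  have hint := (hφ (UComp.distLip0 o)).1
  rw [μ.variation_restrict hR] at hint
  cases μ with
  | pos μ =>
    obtain ⟨ψ, hψ, h⟩ := UComp.exists_mem_lipFree_of_finite_moment hmeas hint
    have heq : φ = ψ := by
      ext f
      exact (hφ f).2.symm.trans (h f).symm
    exact heq ▸ hψ
  | signed μ =>
    -- Both Jordan parts are dominated by `|μ|`, so they inherit measurability and the finite
    -- moment; each gives its own element of the free space.
    have hle₁ : μ.toJordanDecomposition.posPart ≤ μ.totalVariation := Measure.le_add_right le_rfl
    have hle₂ : μ.toJordanDecomposition.negPart ≤ μ.totalVariation := Measure.le_add_left le_rfl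
    have hr₁ := Measure.restrict_mono_measure hle₁ (range (UComp.ι : M → UComp M))
    have hr₂ := Measure.restrict_mono_measure hle₂ (range (UComp.ι : M → UComp M))
    obtain ⟨ψ₁, hψ₁, h₁⟩ := UComp.exists_mem_lipFree_of_finite_moment (hmeas.mono_measure hr₁)
      ((lintegral_mono' hr₁ le_rfl).trans_lt hint)
    obtain ⟨ψ₂, hψ₂, h₂⟩ := UComp.exists_mem_lipFree_of_finite_moment (hmeas.mono_measure hr₂)
      ((lintegral_mono' hr₂ le_rfl).trans_lt hint)
    have heq : φ = ψ₁ - ψ₂ := by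
      ext f
      have h := (hφ f).2
      simp only [GenMeasure.restrict, GenMeasure.integral,
        SignedMeasure.toJordanDecomposition_restrict μ hR] at h
      rw [sub_apply, h₁ f, h₂ f, h]
    exact heq ▸ sub_mem hψ₁ hψ₂

end

end

theorem mainTheorem1 {M : Type*} [MetricSpace M] [CompleteSpace M] (o : M)
    (μ : GenMeasure (UComp M)) (hμ : μ.IsAlmostRadon (UComp.ι o))
    (φ : StrongDual ℝ (Lip0 M o)) (hφ : Induces μ φ) :
    List.TFAE [
      φ ∈ lipFree M o,
      Induces (μ.restrict (range (UComp.ι : M → UComp M))) φ,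
      μ.ConcentratedOn (range (UComp.ι : M → UComp M))] := by
  tfae_have 1 → 3 := concentratedOn_range_of_mem_lipFree hμ hφ
  tfae_have 3 → 2 := fun h => by
    rw [GenMeasure.ConcentratedOn] at h
    rwa [← h]
  tfae_have 2 → 1 := mem_lipFree_of_induces_restrict_range hμ
  tfae_finish
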